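/- Let $G=(V,E,L)$ be a finite graph with loops, where $E$ consists of edges joining two distinct nodes and the loop set is partitioned as $L=L^+\cup L^-$ into plus loops and minus loops. More generally, a hypergraph with loops is a triple $H=(V_H,E_H,L_H)$, where $V_H$ is a finite set, $E_H$ is a set of subsets of $V_H$ of cardinality at least two, and $L_H=L_H^+\cup L_H^-$ is a partitioned set of loops $\{i,i\}$, $i\in V_H$. Let $$\mathrm{PP}(H):=\mathrm{conv}\Big\{z\in\mathbb R^{V_H\cup E_H\cup L_H}:\ z_{ii}\ge z_i^2\ \forall \{i,i\}\in L_H^+,\ z_{ii}\le z_i^2\ \forall\{i,i\}\in L_H^-,\ z_e=\prod_{i\in e}z_i\ \forall e\in E_H,\ z_i\in[0,1]\ \forall i\in V_H\Big\},$$ and write $\mathrm{QP}(G)$ for this set when $H=G$ is a graph. An extended formulation of a convex set $C\subseteq\mathbb R^n$ is a convex set $Q\subseteq\mathbb R^{n+r}$, $r\ge 0$, with $C=\{x: \exists y,\ (x,y)\in Q\}$. Let $V^+:=\{i\in V:\{i,i\}\in L^+\}$, let $V_c$, $c\in\mathcal C$, be the node sets of the connected components of the subgraph of $G$ induced by $V^+$,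 and let $N(V_c):=\{i\in V\setminus V_c: \{i,j\}\in E\text{ for some }j\in V_c\}$. **Proposition.** There are hypergraphs with loops $G'_c$, $c\in\mathcal C\cup\{0\}$, such that: 1. for each $c\in\mathcal C$, $G'_c$ has node set $V_c\cup N(V_c)$, hence $|V_c|+|N(V_c)|$ nodes; its plus loops are those at the nodes of $V_c$, so that there are $|V_c|$ of them; its minus loops are the minus loops of $G$ at its nodes; 2. $G'_0$ has node set $V\setminus V^+$, hence $|V|-\sum_{c\in\mathcal C}|V_c|$ nodes; it has no plus loops, and its minus loops are those of $G$; 3. every node, edge and loop of $G$ is a node, edge or loop, respectively, of some $G'_c$, $c\in\mathcal C\cup\{0\}$, and $\mathrm{QP}(G)$ has an extended formulation obtained by putting together formulations of the $\mathrm{PP}(G'_c)$. That is, for every choice of extended formulations $Q_c$ of $\mathrm{PP}(G'_c)$, $c\in\mathcal C\cup\{0\}$, with $r_c\ge 0$ additional variables $y_c$, the set of all $(w,(y_c)_c)$ with $$\big(w|_{G'_c},\,y_c\big)\in Q_c\quad\text{for all }c\in\mathcal C\cup\{0\}$$ is an extended formulation of $\mathrm{QP}(G)$. Here $w$ has one coordinate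 for each node, edge and loop occurring in some $G'_c$, and $w|_{G'_c}$ is its restriction to the coordinates of $G'_c$. -/

import Mathlib

/-- Names of the lifted variables over the node type `V`: `z_i` for a node `i`, `z_e` for an
edge `e`, and `z_ii` for a loop `{i, i}`. -/
inductive LiftedVar (V : Type*) where
  | node (i : V) : LiftedVar V
  | edge (e : Finset V) : LiftedVar V
  | loop (i : V) : LiftedVar V

/-- A hypergraph with loops `(nodes, edges, L⁻ ∪ L⁺)`, whose nodes are taken from `V`.
Loops are recorded by the node that carries them. -/
structure LoopHypergraph (V : Type*) where
  nodes : Finset V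
  edges : Set (Finset V)
  plus : Finset V
  minus : Finset V
  edge_subset : ∀ e ∈ edges, e ⊆ nodes
  two_le_card : ∀ e ∈ edges, 2 ≤ e.card
  plus_subset : plus ⊆ nodes
  minus_subset : minus ⊆ nodes
  disjoint : Disjoint plus minus

namespace LoopHypergraph

variable {V : Type*} (G : LoopHypergraph V)

/-- The index set `nodes ∪ edges ∪ loops` of the space in which `PP` lives. -/
def vars : Set (LiftedVar V) :=
  {p | match p with
    | .node i => i ∈ G.nodes
    | .edge e => e ∈ G.edges
    | .loop i => i ∈ G.plus ∨ i ∈ G.minus}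

def nodeVar (i : V) (hi : i ∈ G.nodes) : G.vars := ⟨.node i, hi⟩

def edgeVar (e : Finset V) (he : e ∈ G.edges) : G.vars := ⟨.edge e, he⟩

def plusVar (i : V) (hi : i ∈ G.plus) : G.vars := ⟨.loop i, Or.inl hi⟩

def minusVar (i : V) (hi : i ∈ G.minus) : G.vars := ⟨.loop i, Or.inr hi⟩

/-- The convex set `PP(G)` of a hypergraph with loops. -/
def PP : Set (G.vars → ℝ) :=
  convexHull ℝ {z |
    (∀ (i : V) (hi : i ∈ G.plus),
      z (G.nodeVar i (G.plus_subset hi)) ^ 2 ≤ z (G.plusVar i hi)) ∧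
    (∀ (i : V) (hi : i ∈ G.minus),
      z (G.minusVar i hi) ≤ z (G.nodeVar i (G.minus_subset hi)) ^ 2) ∧
    (∀ (e : Finset V) (he : e ∈ G.edges),
      z (G.edgeVar e he) = ∏ i ∈ e.attach, z (G.nodeVar i.1 (G.edge_subset e he i.2))) ∧
    (∀ (i : V) (hi : i ∈ G.nodes), z (G.nodeVar i hi) ∈ Set.Icc (0 : ℝ) 1)}

end LoopHypergraph

/-- A graph `G = (V, E, L)` with plus loops and minus loops on the node set `V`. -/
structure LoopGraph (V : Type*) where
  graph : SimpleGraph V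
  plus : Finset V
  minus : Finset V
  disjoint : Disjoint plus minus

namespace LoopGraph

variable {V : Type*} [Fintype V] [DecidableEq V] (G : LoopGraph V)

/-- A graph with loops, seen as a hypergraph whose edges are the sets `{i, j}`. -/
def toHypergraph : LoopHypergraph V where
  nodes := Finset.univ
  edges := {e | ∃ i j, G.graph.Adj i j ∧ e = {i, j}}
  plus := G.plus
  minus := G.minus
  edge_subset := fun e _ => Finset.subset_univ e
  two_le_card := by
    rintro e ⟨i, j, hij, rfl⟩
    exact (Finset.card_pair hij.ne).ge
  plus_subset := Finset.subset_univ _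
  minus_subset := Finset.subset_univ _
  disjoint := G.disjoint

/-- The index set `V ∪ E ∪ L` of the space in which `QP(G)` lives. -/
def vars : Set (LiftedVar V) := G.toHypergraph.vars

/-- The convex set `QP(G)` of a graph with loops. -/
def QP : Set (G.vars → ℝ) :=
  convexHull ℝ {z : G.vars → ℝ |
    (∀ (i : V) (hi : i ∈ G.plus),
      z (G.toHypergraph.nodeVar i (Finset.mem_univ i)) ^ 2 ≤
        z (G.toHypergraph.plusVar i hi)) ∧
    (∀ (i : V) (hi : i ∈ G.minus),
      z (G.toHypergraph.minusVar i hi) ≤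
        z (G.toHypergraph.nodeVar i (Finset.mem_univ i)) ^ 2) ∧
    (∀ (i j : V) (hij : G.graph.Adj i j),
      z (G.toHypergraph.edgeVar {i, j} ⟨i, j, hij, rfl⟩) =
        z (G.toHypergraph.nodeVar i (Finset.mem_univ i)) *
          z (G.toHypergraph.nodeVar j (Finset.mem_univ j))) ∧
    (∀ i : V, z (G.toHypergraph.nodeVar i (Finset.mem_univ i)) ∈ Set.Icc (0 : ℝ) 1)}

/-- The index set of the connected components of the subgraph induced by the plus-loop nodes. -/
abbrev PlusComponent : Type _ := (G.graph.induce (G.plus : Set V)).ConnectedComponent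

/-- The node set `V_c` of the component `c`. -/
def compNodes (c : G.PlusComponent) : Set V := Subtype.val '' c.supp

/-- The nodes outside `S` that are adjacent to some node of `S`. -/
def neighborhood (S : Set V) : Set V := {i | i ∉ S ∧ ∃ j ∈ S, G.graph.Adj i j}

end LoopGraph

/-- `Q` is an extended formulation of `C`: a convex set in the space with coordinates `κ`, which
include (through `f`) the coordinates `ι` of `C`, whose projection onto these is `C`. -/
def IsExtendedFormulation {ι κ : Type*} (f : ι ↪ κ) (Q : Set (κ → ℝ)) (C : Set (ι → ℝ)) : Prop :=
  Convex ℝ Q ∧ C = {x | ∃ w ∈ Q, ∀ i, w (f i) = x i}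

/-- The system obtained by putting together the systems `Q c`, where `Q c` has the variables of
`H c` and `r c` further variables of its own. Variables of different `H c` with the same name
(the same node, edge or loop) are one variable of the combined system, while the further
variables are kept apart. -/
def putTogether {V I : Type*} (H : I → LoopHypergraph V) (r : I → ℕ)
    (Q : ∀ c, Set ((H c).vars ⊕ Fin (r c) → ℝ)) :
    Set ((⋃ c, (H c).vars : Set (LiftedVar V)) ⊕ (Σ c, Fin (r c)) → ℝ) :=
  {w | ∀ c, (fun p : (H c).vars ⊕ Fin (r c) =>
    w (Sum.map (Set.inclusion (Set.subset_iUnion (fun c => (H c).vars) c)) (Sigma.mk c) p)) ∈ Q c}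

/-! The piece of a component `c` is induced on `V_c ∪ N(V_c)` and the piece `none` on the nodes
without plus loop; every set of at least two such free nodes of a piece is added to it as an edge.
Components are maximal, so two pieces share free nodes only.

A lifted point is affine in each single node value. At a free node a minus loop only asks `t ≤ u ^ 2
≤ u`, so the node can be rounded to 0 and 1. A point of `PP (H c)` is therefore a convex
combination, with weights `a c y`, of points whose free nodes form the indicator of `y`. The added
edges make the moments `∑ a c y [T ⊆ y]` coordinates of the point, and moments determine the weights
(`Finset.eq_of_sum_powerset_superset_eq`). Shared coordinates thus force each `a c` to be the
marginal of the weights of the piece `none`, which contains all free nodes.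

Once the free nodes are fixed to an indicator, what remains of the pieces is independent: a convex
hull of a product is the product of the hulls, and feasible points of the pieces glue to a feasible
point of `G` (`glue_rounded_mem_PP`). Averaging over the weights of `none` recovers the given point
(`restrict_mem_PP`). -/

/-! ### Weights on a power set: moments and marginals -/

open Finset in
/-- A function on the subsets of `N` is determined by its sums over the supersets. -/
theorem Finset.eq_of_sum_powerset_superset_eq {V : Type*} [DecidableEq V] {N : Finset V}
    {a b : Finset V → ℝ}
    (h : ∀ T ⊆ N, ∑ y ∈ N.powerset, a y * (if T ⊆ y then 1 else 0) =
      ∑ y ∈ N.powerset, b y * (if T ⊆ y then 1 else 0)) :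
    ∀ y ⊆ N, a y = b y := by
  intro y hy
  -- Induction from the top of the power set: strict supersets of `y` are already settled, so only
  -- the term at `y` survives.
  induction hn : (N \ y).card using Nat.strong_induction_on generalizing y with
  | _ n ih =>
    have key := h y hy
    have hm : y ∈ N.powerset := mem_powerset.2 hy
    rw [← add_sum_erase _ _ hm, ← add_sum_erase N.powerset (fun y' => b y' * _) hm] at key
    have hrest : ∑ x ∈ N.powerset.erase y, a x * (if y ⊆ x then 1 else 0) =
        ∑ x ∈ N.powerset.erase y, b x * (if y ⊆ x then 1 else 0) := by
      refine sum_congr rfl fun x hx => ?_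
      rw [mem_erase, mem_powerset] at hx
      split_ifs with hyx
      · have hss : y ⊂ x := ssubset_of_subset_of_ne hyx (Ne.symm hx.1)
        have hlt : (N \ x).card < n := by
          rw [← hn, card_sdiff_of_subset hx.2, card_sdiff_of_subset hy]
          have h1 := card_lt_card hss
          have h2 := card_le_card hx.2
          omega
        rw [ih _ hlt x hx.2 rfl]
      · simp
    rw [hrest] at key
    simpa using key

open Finset in
/-- Summation against the marginal, on the subsets of `N`, of a weight on the subsets of `B`. -/
theorem Finset.sum_marginal_mul {V : Type*} [DecidableEq V] (B N : Finset V)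
    (a g : Finset V → ℝ) :
    ∑ y ∈ N.powerset, (∑ x ∈ B.powerset with x ∩ N = y, a x) * g y =
      ∑ x ∈ B.powerset, a x * g (x ∩ N) := by
  rw [← sum_fiberwise_of_maps_to (s := B.powerset) (g := fun x => x ∩ N) (t := N.powerset)
    (fun x _ => mem_powerset.2 inter_subset_right) (fun x => a x * g (x ∩ N))]
  refine sum_congr rfl fun y _ => ?_
  rw [sum_mul]
  exact sum_congr rfl fun x hx => by rw [(mem_filter.1 hx).2]

/-! ### Convex hulls of finite unions -/

open scoped Pointwise in
/-- A point of the convex hull of a finite union of nonempty sets is a convex combination of one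
point in the hull of each of them. -/
theorem exists_weights_of_mem_convexHull_biUnion {E ι : Type*} [AddCommGroup E] [Module ℝ E]
    {s : Finset ι} {F : ι → Set E} (hF : ∀ i ∈ s, (F i).Nonempty) {x : E}
    (hx : x ∈ convexHull ℝ (⋃ i ∈ s, F i)) :
    ∃ (a : ι → ℝ) (p : ι → E), (∀ i ∈ s, 0 ≤ a i) ∧ (∀ i ∈ s, p i ∈ convexHull ℝ (F i)) ∧
      ∑ i ∈ s, a i = 1 ∧ ∑ i ∈ s, a i • p i = x := by
  classical
  let C : Set E := {x | ∃ (a : ι → ℝ) (p : ι → E), (∀ i ∈ s, 0 ≤ a i) ∧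
    (∀ i ∈ s, p i ∈ convexHull ℝ (F i)) ∧ ∑ i ∈ s, a i = 1 ∧ ∑ i ∈ s, a i • p i = x}
  suffices h : convexHull ℝ (⋃ i ∈ s, F i) ⊆ C from h hx
  refine convexHull_min ?_ ?_
  · intro x hx
    simp only [Set.mem_iUnion] at hx
    obtain ⟨i, hi, hx⟩ := hx
    choose! q hq using hF
    -- The sets other than `F i` get weight 0, but still need some point; this is where nonemptiness
    -- enters.
    refine ⟨fun j => if j = i then 1 else 0, Function.update q i x, ?_, ?_, ?_, ?_⟩
    · intro j _
      dsimp only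
      split_ifs <;> norm_num
    · intro j hj
      rcases eq_or_ne j i with rfl | hji
      · simpa using subset_convexHull ℝ _ hx
      · simpa [hji] using subset_convexHull ℝ _ (hq j hj)
    · simp [hi]
    · simp [hi]
  · rintro x ⟨a, p, ha, hp, ha1, rfl⟩ x' ⟨a', p', ha', hp', ha1', rfl⟩ b b' hb hb' hbb
    -- Convexity merges the two points in each hull into one; the scaled form avoids dividing by a
    -- total weight that may vanish.
    have hex : ∀ i ∈ s, ∃ q ∈ convexHull ℝ (F i),
        (b * a i + b' * a' i) • q = (b * a i) • p i + (b' * a' i) • p' i := by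
      intro i hi
      have hmem : (b * a i) • p i + (b' * a' i) • p' i ∈
          (b * a i + b' * a' i) • convexHull ℝ (F i) := by
        rw [(convex_convexHull ℝ (F i)).add_smul (mul_nonneg hb (ha i hi))
          (mul_nonneg hb' (ha' i hi))]
        exact Set.add_mem_add (Set.smul_mem_smul_set (hp i hi)) (Set.smul_mem_smul_set (hp' i hi))
      obtain ⟨q, hq, he⟩ := hmem
      exact ⟨q, hq, he⟩
    choose! q hq hqe using hex
    refine ⟨fun i => b * a i + b' * a' i, q, ?_, hq, ?_, ?_⟩
    · exact fun i hi => add_nonneg (mul_nonneg hb (ha i hi)) (mul_nonneg hb' (ha' i hi))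
    · rw [Finset.sum_add_distrib, ← Finset.mul_sum, ← Finset.mul_sum, ha1, ha1']
      simpa using hbb
    · rw [Finset.sum_congr rfl hqe, Finset.sum_add_distrib, Finset.smul_sum, Finset.smul_sum]
      simp only [smul_smul]

/-! ### Lifted points -/

namespace LiftedVar

variable {V : Type*}

/-- The lifted point with node values `u`, loop values `t`, and the products of the node values at
the edges. -/
def lift (u t : V → ℝ) : LiftedVar V → ℝ
  | node i => u i
  | edge e => ∏ i ∈ e, u i
  | loop i => t i

/-- A lifted point is affine in the value at a single node, up to a shift of the loop value. -/
theorem lift_eq_add_lift_update [DecidableEq V] (u t : V → ℝ) (i : V) :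
    lift u t = (1 - u i) • lift (Function.update u i 0) (Function.update t i (t i - u i)) +
      u i • lift (Function.update u i 1) (Function.update t i (t i - u i + 1)) := by
  funext v
  cases v with
  | node j =>
    rcases eq_or_ne j i with rfl | h
    · simp [lift]
    · simp [lift, h]; ring
  | edge e =>
    by_cases h : i ∈ e
    · simp only [lift, Pi.add_apply, Pi.smul_apply, smul_eq_mul, Finset.prod_update_of_mem h]
      rw [← Finset.mul_prod_erase e u h, Finset.sdiff_singleton_eq_erase]
      ring
    · simp only [lift, Pi.add_apply, Pi.smul_apply, smul_eq_mul, Finset.prod_update_of_notMem h]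
      ring
  | loop j =>
    rcases eq_or_ne j i with rfl | h
    · simp [lift]; ring
    · simp [lift, h]; ring

end LiftedVar

/-! ### Rounding the nodes without plus loop -/

namespace LoopHypergraph

open LiftedVar

variable {V : Type*} (H : LoopHypergraph V)

/-- The constraints of `PP` on the node values `u` and the loop values `t`. -/
structure Feasible (u t : V → ℝ) : Prop where
  plus : ∀ i ∈ H.plus, u i ^ 2 ≤ t i
  minus : ∀ i ∈ H.minus, t i ≤ u i ^ 2
  mem_Icc : ∀ i, u i ∈ Set.Icc (0 : ℝ) 1

/-- The feasible lifted points. -/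
def feasibleSet : Set (LiftedVar V → ℝ) := {w | ∃ u t, H.Feasible u t ∧ w = lift u t}

/-- `PP` consists of the restrictions of convex combinations of feasible lifted points. -/
theorem mem_PP_iff {z : H.vars → ℝ} :
    z ∈ H.PP ↔ ∃ w ∈ convexHull ℝ H.feasibleSet, ∀ v : H.vars, w v = z v := by
  classical
  let R : (LiftedVar V → ℝ) →ₗ[ℝ] (H.vars → ℝ) := LinearMap.funLeft ℝ ℝ Subtype.val
  have hR : ∀ w (v : H.vars), R w v = w v := fun _ _ => rfl
  have : H.PP = R '' convexHull ℝ H.feasibleSet := by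
    rw [R.image_convexHull, PP]
    congr 1
    ext z
    constructor
    · rintro ⟨h1, h2, h3, h4⟩
      -- The default 0 keeps the bounds `[0, 1]` valid at elements of `V` that are not nodes.
      let u : V → ℝ := fun i => if h : i ∈ H.nodes then z (H.nodeVar i h) else 0
      let t : V → ℝ := fun i =>
        if h : i ∈ H.plus ∨ i ∈ H.minus then z ⟨.loop i, h⟩ else 0
      have hu : ∀ i (h : i ∈ H.nodes), u i = z (H.nodeVar i h) := fun i h => dif_pos h
      have ht : ∀ i (h : i ∈ H.plus ∨ i ∈ H.minus), t i = z ⟨.loop i, h⟩ := fun i h => dif_pos h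
      refine ⟨lift u t, ⟨u, t, ⟨?_, ?_, ?_⟩, rfl⟩, ?_⟩
      · intro i hi
        rw [hu i (H.plus_subset hi), ht i (Or.inl hi)]
        exact h1 i hi
      · intro i hi
        rw [hu i (H.minus_subset hi), ht i (Or.inr hi)]
        exact h2 i hi
      · intro i
        by_cases h : i ∈ H.nodes
        · rw [hu i h]
          exact h4 i h
        · simp [u, h]
      · funext ⟨v, hv⟩
        rw [hR]
        cases v with
        | node i => exact hu i hv
        | edge e =>
          refine Eq.trans ?_ (h3 e hv).symm
          rw [lift, ← Finset.prod_attach]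
          exact Finset.prod_congr rfl fun i _ => hu i.1 (H.edge_subset e hv i.2)
        | loop i => exact ht i hv
    · rintro ⟨_, ⟨u, t, h, rfl⟩, rfl⟩
      refine ⟨h.plus, h.minus, fun e he => ?_, fun i _ => h.mem_Icc i⟩
      exact (Finset.prod_attach e u).symm
  rw [this]
  constructor
  · rintro ⟨w, hw, rfl⟩
    exact ⟨w, hw, fun _ => rfl⟩
  · rintro ⟨w, hw, h⟩
    exact ⟨w, hw, funext h⟩

variable [DecidableEq V]

/-- The nodes without a plus loop. -/
def freeNodes : Finset V := H.nodes \ H.plus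

/-- The feasible lifted points whose value at the nodes without a plus loop is the indicator
of `y`. -/
def roundedSet (y : Finset V) : Set (LiftedVar V → ℝ) :=
  {w | ∃ u t, H.Feasible u t ∧ (∀ i ∈ H.freeNodes, u i = if i ∈ y then 1 else 0) ∧ w = lift u t}

/-- Loop values equal to the squares satisfy plus and minus loops alike. -/
theorem roundedSet_nonempty (y : Finset V) : (H.roundedSet y).Nonempty := by
  let u : V → ℝ := fun i => if i ∈ y then 1 else 0
  refine ⟨_, u, fun i => u i ^ 2, ⟨fun i _ => le_rfl, fun i _ => le_rfl, fun i => ?_⟩,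
    fun i _ => rfl, rfl⟩
  simp only [u]
  split_ifs <;> simp

/-- Replacing `u i` by 0 and 1 with weights `1 - u i` and `u i` shifts the loop value to `t i - u i`
and `t i - u i + 1`. A minus loop permits both, since `t i ≤ u i ^ 2 ≤ u i`. -/
theorem Feasible.mem_convexHull_update {H : LoopHypergraph V} {u t : V → ℝ} (h : H.Feasible u t)
    {i : V} (hi : i ∉ H.plus) {S : Set (LiftedVar V → ℝ)}
    (hS : ∀ b s : ℝ, (b = 0 ∨ b = 1) →
      H.Feasible (Function.update u i b) (Function.update t i s) →
      lift (Function.update u i b) (Function.update t i s) ∈ S) :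
    lift u t ∈ convexHull ℝ S := by
  have h01 := h.mem_Icc i
  have hf : ∀ b s : ℝ, (b = 0 ∨ b = 1) → (i ∈ H.minus → s ≤ b ^ 2) →
      H.Feasible (Function.update u i b) (Function.update t i s) := by
    intro b s hb hs
    refine ⟨fun j hj => ?_, fun j hj => ?_, fun j => ?_⟩
    · have : j ≠ i := fun e => hi (e ▸ hj)
      simpa [this] using h.plus j hj
    · rcases eq_or_ne j i with rfl | hji
      · simpa using hs hj
      · simpa [hji] using h.minus j hj
    · rcases eq_or_ne j i with rfl | hji
      · rcases hb with rfl | rfl <;> simp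
      · simpa [hji] using h.mem_Icc j
  have hle : i ∈ H.minus → t i ≤ u i := fun hm =>
    (h.minus i hm).trans (by nlinarith [h01.1, h01.2])
  rw [lift_eq_add_lift_update u t i]
  refine convex_convexHull ℝ S (subset_convexHull ℝ S (hS _ _ (Or.inl rfl) ?_))
    (subset_convexHull ℝ S (hS _ _ (Or.inr rfl) ?_)) (by linarith [h01.2]) h01.1 (by ring)
  · exact hf _ _ (Or.inl rfl) fun hm => by linarith [hle hm]
  · exact hf _ _ (Or.inr rfl) fun hm => by linarith [hle hm]

/-- A feasible lifted point is a convex combination of feasible ones that are binary on `U`, for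
a set `U` of nodes without plus loop. -/
theorem feasibleSet_subset_convexHull_binary (U : Finset V) (hU : U ⊆ H.freeNodes) :
    H.feasibleSet ⊆ convexHull ℝ
      {w | ∃ u t, H.Feasible u t ∧ (∀ i ∈ U, u i = 0 ∨ u i = 1) ∧ w = lift u t} := by
  induction U using Finset.induction_on with
  | empty =>
    rintro _ ⟨u, t, h, rfl⟩
    exact subset_convexHull ℝ _ ⟨u, t, h, by simp, rfl⟩
  | insert i U hiU ih =>
    refine (ih ((Finset.subset_insert i U).trans hU)).trans
      (convexHull_min ?_ (convex_convexHull ℝ _))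
    rintro _ ⟨u, t, h, hb, rfl⟩
    have hi : i ∉ H.plus := (Finset.mem_sdiff.1 (hU (Finset.mem_insert_self i U))).2
    refine h.mem_convexHull_update hi fun b s hb' hf => ⟨_, _, hf, fun j hj => ?_, rfl⟩
    rcases eq_or_ne j i with rfl | hji
    · simpa using hb'
    · simpa [hji] using hb j ((Finset.mem_insert.1 hj).resolve_left hji)

theorem convexHull_feasibleSet_subset :
    convexHull ℝ H.feasibleSet ⊆
      convexHull ℝ (⋃ y ∈ H.freeNodes.powerset, H.roundedSet y) := by
  refine convexHull_min ((H.feasibleSet_subset_convexHull_binary _ subset_rfl).trans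
    (convexHull_mono ?_)) (convex_convexHull ℝ _)
  rintro _ ⟨u, t, h, hb, rfl⟩
  simp only [Set.mem_iUnion]
  refine ⟨H.freeNodes.filter (u · = 1), Finset.mem_powerset.2 (Finset.filter_subset _ _),
    u, t, h, fun i hi => ?_, rfl⟩
  rcases hb i hi with h0 | h1
  · simp [h0]
  · simp [h1, hi]

theorem node_eq_of_mem_convexHull_roundedSet {y : Finset V} {w : LiftedVar V → ℝ}
    (hw : w ∈ convexHull ℝ (H.roundedSet y)) {i : V} (hi : i ∈ H.freeNodes) :
    w (.node i) = if i ∈ y then 1 else 0 := by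
  have hc : Convex ℝ {w : LiftedVar V → ℝ | w (.node i) = if i ∈ y then 1 else 0} :=
    convex_hyperplane (LinearMap.proj (LiftedVar.node i)).isLinear _
  refine convexHull_min ?_ hc hw
  rintro _ ⟨u, t, -, hu, rfl⟩
  exact hu i hi

/-- A product of indicators is an indicator, and a linear equation passes to the hull. Edge
coordinates of a convex combination thereby become moments of its weights. -/
theorem edge_eq_of_mem_convexHull_roundedSet {y : Finset V} {w : LiftedVar V → ℝ}
    (hw : w ∈ convexHull ℝ (H.roundedSet y)) {T : Finset V} (hT : T ⊆ H.freeNodes) :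
    w (.edge T) = if T ⊆ y then 1 else 0 := by
  have hc : Convex ℝ {w : LiftedVar V → ℝ | w (.edge T) = if T ⊆ y then 1 else 0} :=
    convex_hyperplane (LinearMap.proj (LiftedVar.edge T)).isLinear _
  refine convexHull_min ?_ hc hw
  rintro _ ⟨u, t, -, hu, rfl⟩
  change ∏ i ∈ T, u i = _
  rw [Finset.prod_congr rfl fun i hi => hu i (hT hi), Finset.prod_ite_zero]
  simp [Finset.subset_iff]

end LoopHypergraph

/-! ### Gluing along free nodes -/

namespace LoopHypergraph

open LiftedVar

variable {V : Type*} [DecidableEq V] {I : Type*}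

/-- The hypergraphs `H c` cover `G` and overlap only in nodes without plus loop. All sets of such
nodes are edges, and all such nodes belong to `H o`. -/
structure IsGluing (G : LoopHypergraph V) (H : I → LoopHypergraph V) (o : I) : Prop where
  plus_subset : ∀ c, (H c).plus ⊆ G.plus
  minus_subset : ∀ c, (H c).minus ⊆ G.minus
  vars_subset : G.vars ⊆ ⋃ c, (H c).vars
  eq_of_mem_plus : ∀ c, ∀ i ∈ (H c).plus, ∀ c', i ∈ (H c').nodes → c' = c
  freeNodes_subset : ∀ c, (H c).freeNodes ⊆ (H o).freeNodes
  mem_edges : ∀ c, ∀ T ⊆ (H c).freeNodes, 2 ≤ T.card → T ∈ (H c).edges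

namespace IsGluing

variable {G : LoopHypergraph V} {H : I → LoopHypergraph V} {o : I}

/-- A point of `PP G` extends to a point whose restrictions lie in the sets `PP (H c)`. -/
theorem exists_lift (h : IsGluing G H o) {z : G.vars → ℝ} (hz : z ∈ G.PP) :
    ∃ w : LiftedVar V → ℝ, (∀ c, (fun v : (H c).vars => w v) ∈ (H c).PP) ∧
      ∀ v : G.vars, w v = z v := by
  obtain ⟨w, hw, hwz⟩ := G.mem_PP_iff.1 hz
  refine ⟨w, fun c => (H c).mem_PP_iff.2 ⟨w, convexHull_mono ?_ hw, fun _ => rfl⟩, hwz⟩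
  rintro _ ⟨u, t, hf, rfl⟩
  exact ⟨u, t, ⟨fun i hi => hf.plus i (h.plus_subset c hi),
    fun i hi => hf.minus i (h.minus_subset c hi), hf.mem_Icc⟩, rfl⟩

/-- Feasible lifted points for the `H c` that all round the nodes without plus loop to the
indicator of `x` fit together to a point of `PP G`. -/
theorem glue_rounded_mem_PP (h : IsGluing G H o) (x : Finset V) (owner : G.vars → I)
    (howner : ∀ v, v.1 ∈ (H (owner v)).vars) (f : I → LiftedVar V → ℝ)
    (hf : ∀ c, f c ∈ (H c).roundedSet (x ∩ (H c).freeNodes)) :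
    (fun v : G.vars => f (owner v) v) ∈ G.PP := by
  classical
  choose u t hfeas hround hlift using hf
  let U : V → ℝ := fun i => if hi : ∃ c, i ∈ (H c).nodes then u hi.choose i else 0
  have hU : ∀ c i, i ∈ (H c).nodes → U i = u c i := by
    intro c i hi
    have hex : ∃ c, i ∈ (H c).nodes := ⟨c, hi⟩
    have hval : U i = u hex.choose i := dif_pos hex
    rw [hval]
    have hi' := hex.choose_spec
    generalize hex.choose = c' at hi' ⊢
    -- A plus node lies in one piece only; at a free node both values are the indicator of `x`.
    by_cases hp : i ∈ (H c).plus
    · rw [h.eq_of_mem_plus c i hp c' hi']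
    by_cases hp' : i ∈ (H c').plus
    · rw [h.eq_of_mem_plus c' i hp' c hi]
    have h1 : i ∈ (H c).freeNodes := Finset.mem_sdiff.2 ⟨hi, hp⟩
    have h2 : i ∈ (H c').freeNodes := Finset.mem_sdiff.2 ⟨hi', hp'⟩
    rw [hround c i h1, hround c' i h2]
    simp [h1, h2]
  -- Pieces sharing a minus loop may disagree on its value, so the owner's value is taken.
  let T : V → ℝ := fun i => if hi : LiftedVar.loop i ∈ G.vars then t (owner ⟨_, hi⟩) i else 0
  have hT : ∀ i (hi : LiftedVar.loop i ∈ G.vars), T i = t (owner ⟨_, hi⟩) i :=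
    fun i hi => dif_pos hi
  refine G.mem_PP_iff.2 ⟨lift U T, subset_convexHull ℝ _ ⟨U, T, ⟨?_, ?_, ?_⟩, rfl⟩, ?_⟩
  · intro i hi
    have hv : LiftedVar.loop i ∈ G.vars := Or.inl hi
    rw [hT i hv]
    have ho : i ∈ (H (owner ⟨_, hv⟩)).plus := (howner ⟨_, hv⟩).resolve_right fun hm =>
      Finset.disjoint_left.1 G.disjoint hi (h.minus_subset _ hm)
    rw [hU _ i ((H _).plus_subset ho)]
    exact (hfeas _).plus i ho
  · intro i hi
    have hv : LiftedVar.loop i ∈ G.vars := Or.inr hi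
    rw [hT i hv]
    have ho : i ∈ (H (owner ⟨_, hv⟩)).minus := (howner ⟨_, hv⟩).resolve_left fun hm =>
      Finset.disjoint_left.1 G.disjoint (h.plus_subset _ hm) hi
    rw [hU _ i ((H _).minus_subset ho)]
    exact (hfeas _).minus i ho
  · intro i
    by_cases hi : ∃ c, i ∈ (H c).nodes
    · obtain ⟨c, hi⟩ := hi
      rw [hU c i hi]
      exact (hfeas c).mem_Icc i
    · simp [U, hi]
  · rintro ⟨v, hv⟩
    have ho := howner ⟨v, hv⟩
    change lift U T v = f (owner ⟨v, hv⟩) v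
    rw [hlift]
    cases v with
    | node i => exact hU _ i ho
    | edge e => exact Finset.prod_congr rfl fun i hi => hU _ i ((H _).edge_subset e ho hi)
    | loop i => exact hT i hv

/-- A point whose restrictions lie in the sets `PP (H c)` restricts to a point of `PP G`. -/
theorem restrict_mem_PP [Finite I] (h : IsGluing G H o) {w : LiftedVar V → ℝ}
    (hw : ∀ c, (fun v : (H c).vars => w v) ∈ (H c).PP) :
    (fun v : G.vars => w v) ∈ G.PP := by
  have hdec : ∀ c, ∃ (a : Finset V → ℝ) (p : Finset V → LiftedVar V → ℝ),
      (∀ y ∈ (H c).freeNodes.powerset, 0 ≤ a y) ∧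
      (∀ y ∈ (H c).freeNodes.powerset, p y ∈ convexHull ℝ ((H c).roundedSet y)) ∧
      ∑ y ∈ (H c).freeNodes.powerset, a y = 1 ∧
      ∀ v ∈ (H c).vars, ∑ y ∈ (H c).freeNodes.powerset, a y * p y v = w v := by
    intro c
    obtain ⟨w', hw', he⟩ := (H c).mem_PP_iff.1 (hw c)
    obtain ⟨a, p, ha, hp, ha1, hsum⟩ := exists_weights_of_mem_convexHull_biUnion
      (fun y _ => (H c).roundedSet_nonempty y) ((H c).convexHull_feasibleSet_subset hw')
    refine ⟨a, p, ha, hp, ha1, fun v hv => ?_⟩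
    rw [← he ⟨v, hv⟩, ← hsum]
    simp
  choose a p ha hp ha1 hsum using hdec
  -- The right side depends on `w` and `T` but not on `c`, which makes the moments of different
  -- pieces comparable. Sets of size 0 and 1 are not edges and are read off from the total weight
  -- and the node variable.
  have hmoment : ∀ c, ∀ T ⊆ (H c).freeNodes,
      ∑ y ∈ (H c).freeNodes.powerset, a c y * (if T ⊆ y then 1 else 0) =
        if T.card = 0 then 1 else if hT : T.card = 1 then
          w (.node (Finset.card_eq_one.1 hT).choose) else w (.edge T) := by
    intro c T hT
    split_ifs with h0 h1
    · rw [Finset.card_eq_zero.1 h0]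
      simpa using ha1 c
    · have hTe := (Finset.card_eq_one.1 h1).choose_spec
      generalize (Finset.card_eq_one.1 h1).choose = i at hTe ⊢
      subst hTe
      rw [Finset.singleton_subset_iff] at hT
      have hv : LiftedVar.node i ∈ (H c).vars := (Finset.mem_sdiff.1 hT).1
      rw [← hsum c _ hv]
      refine Finset.sum_congr rfl fun y hy => ?_
      rw [(H c).node_eq_of_mem_convexHull_roundedSet (hp c y hy) hT]
      simp
    · have hv : LiftedVar.edge T ∈ (H c).vars := h.mem_edges c T hT (by omega)
      rw [← hsum c _ hv]
      refine Finset.sum_congr rfl fun y hy => ?_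
      rw [(H c).edge_eq_of_mem_convexHull_roundedSet (hp c y hy) hT]
  have hmarginal : ∀ c, ∀ y ⊆ (H c).freeNodes, a c y =
      ∑ x ∈ (H o).freeNodes.powerset with x ∩ (H c).freeNodes = y, a o x := by
    intro c
    refine Finset.eq_of_sum_powerset_superset_eq fun T hT => ?_
    rw [Finset.sum_marginal_mul, hmoment c T hT,
      ← hmoment o T (hT.trans (h.freeNodes_subset c))]
    refine Finset.sum_congr rfl fun x _ => ?_
    simp [Finset.subset_inter_iff, hT]
  have hex : ∀ v : G.vars, ∃ c, v.1 ∈ (H c).vars := fun v => Set.mem_iUnion.1 (h.vars_subset v.2)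
  choose owner howner using hex
  let P : Finset V → G.vars → ℝ := fun x v => p (owner v) (x ∩ (H (owner v)).freeNodes) v
  have hP : ∀ x, P x ∈ G.PP := by
    intro x
    -- Reading each coordinate from its owner is linear, so gluing need only be checked on tuples of
    -- rounded feasible points.
    let A : (I → LiftedVar V → ℝ) →ₗ[ℝ] (G.vars → ℝ) :=
      { toFun := fun f v => f (owner v) v
        map_add' := fun _ _ => rfl
        map_smul' := fun _ _ => rfl }
    let F : I → Set (LiftedVar V → ℝ) := fun c => (H c).roundedSet (x ∩ (H c).freeNodes)
    have hmem : (fun c => p c (x ∩ (H c).freeNodes)) ∈ convexHull ℝ (Set.univ.pi F) := by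
      refine mem_convexHull_pi fun c _ => hp c _ (Finset.mem_powerset.2 Finset.inter_subset_right)
    have himg : A (fun c => p c (x ∩ (H c).freeNodes)) ∈ convexHull ℝ (A '' Set.univ.pi F) := by
      rw [← A.image_convexHull]
      exact ⟨_, hmem, rfl⟩
    refine convexHull_min ?_ (convex_convexHull ℝ _) himg
    rintro _ ⟨f, hf, rfl⟩
    exact h.glue_rounded_mem_PP x owner howner f fun c => hf c trivial
  -- Each coordinate is expanded in its owner's weights, which are then replaced by marginals of `a
  -- o`.
  have hcomb : (fun v : G.vars => w v) = ∑ x ∈ (H o).freeNodes.powerset, a o x • P x := by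
    funext v
    rw [← hsum _ _ (howner v), Finset.sum_congr rfl fun y hy =>
      congrArg (· * _) (hmarginal (owner v) y (Finset.mem_powerset.1 hy)),
      Finset.sum_marginal_mul]
    simp [P]
  rw [hcomb]
  exact (convex_convexHull ℝ _).sum_mem (ha o) (ha1 o) fun x _ => hP x

/-- Putting together extended formulations of the `PP (H c)` gives one of `PP G`. -/
theorem isExtendedFormulation_putTogether [Finite I] (h : IsGluing G H o) (r : I → ℕ)
    (Q : ∀ c, Set ((H c).vars ⊕ Fin (r c) → ℝ))
    (hQ : ∀ c, IsExtendedFormulation Function.Embedding.inl (Q c) (H c).PP) :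
    IsExtendedFormulation
      ((Set.embeddingOfSubset _ _ h.vars_subset).trans Function.Embedding.inl)
      (putTogether H r Q) G.PP := by
  classical
  refine ⟨?_, ?_⟩
  · intro w hw w' hw' b b' hb hb' hbb c
    exact (hQ c).1 (hw c) (hw' c) hb hb' hbb
  ext z
  constructor
  · intro hz
    obtain ⟨w, hw, hwz⟩ := h.exists_lift hz
    have hq : ∀ c, ∃ q ∈ Q c, ∀ v : (H c).vars, q (Sum.inl v) = w v := by
      intro c
      have hc := hw c
      rw [(hQ c).2] at hc
      exact hc
    choose q hqQ hqw using hq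
    refine ⟨Sum.elim (fun v => w v) (fun k => q k.1 (Sum.inr k.2)), fun c => ?_, hwz⟩
    convert hqQ c using 1
    funext k
    cases k with
    | inl v => exact (hqw c v).symm
    | inr k => rfl
  · rintro ⟨w, hw, hwz⟩
    let w' : LiftedVar V → ℝ := fun v =>
      if hv : v ∈ ⋃ c, (H c).vars then w (Sum.inl ⟨v, hv⟩) else 0
    have hw' : ∀ v (hv : v ∈ ⋃ c, (H c).vars), w' v = w (Sum.inl ⟨v, hv⟩) :=
      fun v hv => dif_pos hv
    have hPP : ∀ c, (fun v : (H c).vars => w' v) ∈ (H c).PP := by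
      intro c
      rw [(hQ c).2]
      exact ⟨_, hw c, fun v => (hw' v.1 (Set.mem_iUnion.2 ⟨c, v.2⟩)).symm⟩
    convert h.restrict_mem_PP hPP using 1
    funext v
    rw [hw' v.1 (h.vars_subset v.2)]
    exact (hwz v).symm

end IsGluing

/-! ### Completing induced pieces -/

/-- The sub-hypergraph of `G` induced by `S`, to which all sets of at least two nodes without
plus loop are added as edges. -/
def inducedCompletion (G : LoopHypergraph V) (S : Finset V) : LoopHypergraph V where
  nodes := S
  edges := {e | e ⊆ S ∧ 2 ≤ e.card ∧ (e ∈ G.edges ∨ Disjoint e G.plus)}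
  plus := G.plus ∩ S
  minus := G.minus ∩ S
  edge_subset := fun _ he => he.1
  two_le_card := fun _ he => he.2.1
  plus_subset := Finset.inter_subset_right
  minus_subset := Finset.inter_subset_right
  disjoint := G.disjoint.mono Finset.inter_subset_left Finset.inter_subset_left

theorem mem_freeNodes_inducedCompletion {G : LoopHypergraph V} {S : Finset V} {i : V} :
    i ∈ (G.inducedCompletion S).freeNodes ↔ i ∈ S ∧ i ∉ G.plus := by
  simp only [freeNodes, inducedCompletion, Finset.mem_sdiff, Finset.mem_inter]
  tauto

theorem isGluing_inducedCompletion (G : LoopHypergraph V) (S : I → Finset V) (o : I)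
    (hnodes : ∀ i ∈ G.nodes, ∃ c, i ∈ S c) (hedges : ∀ e ∈ G.edges, ∃ c, e ⊆ S c)
    (hplus : ∀ c, ∀ i ∈ G.plus, i ∈ S c → ∀ c', i ∈ S c' → c' = c)
    (ho : ∀ c, ∀ i ∈ S c, i ∉ G.plus → i ∈ S o) :
    IsGluing G (fun c => G.inducedCompletion (S c)) o where
  plus_subset _ := Finset.inter_subset_left
  minus_subset _ := Finset.inter_subset_left
  vars_subset := by
    intro v hv
    rw [Set.mem_iUnion]
    cases v with
    | node i => exact hnodes i hv
    | edge e =>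
      obtain ⟨c, hc⟩ := hedges e hv
      exact ⟨c, hc, G.two_le_card e hv, Or.inl hv⟩
    | loop i =>
      obtain ⟨c, hc⟩ := hnodes i (hv.elim (G.plus_subset ·) (G.minus_subset ·))
      exact ⟨c, hv.imp (fun h => Finset.mem_inter.2 ⟨h, hc⟩)
        (fun h => Finset.mem_inter.2 ⟨h, hc⟩)⟩
  eq_of_mem_plus c i hi :=
    hplus c i (Finset.mem_inter.1 hi).1 (Finset.mem_inter.1 hi).2
  freeNodes_subset c i hi := by
    rw [mem_freeNodes_inducedCompletion] at hi ⊢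
    exact ⟨ho c i hi.1 hi.2, hi.2⟩
  mem_edges c T hT hcard :=
    ⟨fun i hi => (mem_freeNodes_inducedCompletion.1 (hT hi)).1, hcard,
      Or.inr (Finset.disjoint_left.2 fun i hi =>
        (mem_freeNodes_inducedCompletion.1 (hT hi)).2)⟩

end LoopHypergraph

/-! ### Components of the plus nodes and their neighbourhoods -/

namespace LoopGraph

variable {V : Type*} (G : LoopGraph V)

theorem mem_compNodes {c : G.PlusComponent} {i : V} :
    i ∈ G.compNodes c ↔ ∃ hi : i ∈ (G.plus : Set V),
      (G.graph.induce (G.plus : Set V)).connectedComponentMk ⟨i, hi⟩ = c := by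
  simp [compNodes]

theorem compNodes_subset_plus (c : G.PlusComponent) : G.compNodes c ⊆ G.plus :=
  fun _ hi => (G.mem_compNodes.1 hi).1

theorem eq_of_mem_compNodes {c c' : G.PlusComponent} {i : V} (h : i ∈ G.compNodes c)
    (h' : i ∈ G.compNodes c') : c' = c := by
  obtain ⟨_, rfl⟩ := G.mem_compNodes.1 h
  obtain ⟨_, rfl⟩ := G.mem_compNodes.1 h'
  rfl

theorem exists_mem_compNodes {i : V} (hi : i ∈ G.plus) : ∃ c, i ∈ G.compNodes c :=
  ⟨_, G.mem_compNodes.2 ⟨hi, rfl⟩⟩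

theorem mem_compNodes_of_adj {c : G.PlusComponent} {i j : V} (hi : i ∈ G.compNodes c)
    (hij : G.graph.Adj i j) (hj : j ∈ G.plus) : j ∈ G.compNodes c := by
  obtain ⟨hp, rfl⟩ := G.mem_compNodes.1 hi
  refine G.mem_compNodes.2 ⟨hj, SimpleGraph.ConnectedComponent.sound ?_⟩
  exact SimpleGraph.Adj.reachable (G := G.graph.induce (G.plus : Set V)) hij.symm

/-- A plus node adjacent to a component already belongs to it. Hence the plus nodes of a piece are
exactly those of its component. -/
theorem notMem_plus_of_mem_neighborhood {c : G.PlusComponent} {i : V}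
    (hi : i ∈ G.neighborhood (G.compNodes c)) : i ∉ G.plus := by
  obtain ⟨hic, j, hj, hij⟩ := hi
  exact fun hp => hic (G.mem_compNodes_of_adj hj hij.symm hp)

theorem mem_neighborhood_of_adj {S : Set V} {i j : V} (hi : i ∈ S) (hij : G.graph.Adj i j) :
    j ∈ S ∪ G.neighborhood S := by
  by_cases hj : j ∈ S
  · exact Or.inl hj
  · exact Or.inr ⟨hj, i, hi, hij.symm⟩

theorem disjoint_neighborhood (S : Set V) : Disjoint S (G.neighborhood S) :=
  Set.disjoint_left.2 fun _ hi h => h.1 hi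

theorem finsum_ncard_compNodes [Fintype V] : ∑ᶠ c, (G.compNodes c).ncard = G.plus.card := by
  rw [← Set.ncard_iUnion_of_finite (fun _ => Set.toFinite _), ← Set.ncard_coe_finset]
  · congr 1
    ext i
    rw [Set.mem_iUnion]
    exact ⟨fun ⟨c, hc⟩ => G.compNodes_subset_plus c hc, fun hi => G.exists_mem_compNodes hi⟩
  · intro c c' hcc
    exact Set.disjoint_left.2 fun i hi hi' => hcc (G.eq_of_mem_compNodes hi' hi)

variable [Fintype V] [DecidableEq V]

theorem QP_eq_PP_toHypergraph : G.QP = G.toHypergraph.PP := by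
  rw [QP, LoopHypergraph.PP]
  congr 1
  ext z
  refine and_congr_right fun _ => and_congr_right fun _ => and_congr ?_ ?_
  · constructor
    · rintro h _ ⟨i, j, hij, rfl⟩
      refine (h i j hij).trans ?_
      rw [Finset.prod_attach ({i, j} : Finset V)
        (fun k => z (G.toHypergraph.nodeVar k (Finset.mem_univ k))), Finset.prod_pair hij.ne]
    · intro h i j hij
      refine (h _ ⟨i, j, hij, rfl⟩).trans ?_
      rw [Finset.prod_attach ({i, j} : Finset V)
        (fun k => z (G.toHypergraph.nodeVar k (Finset.mem_univ k))), Finset.prod_pair hij.ne]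
  · exact forall_congr' fun i => ⟨fun h _ => h, fun h => h (Finset.mem_univ i)⟩

open Classical in
/-- The node sets of the decomposition: a component of the plus nodes together with its
neighbourhood, or all nodes without plus loop. -/
noncomputable def pieceNodes : Option G.PlusComponent → Finset V
  | some c => (G.compNodes c ∪ G.neighborhood (G.compNodes c)).toFinset
  | none => Finset.univ \ G.plus

theorem mem_pieceNodes_some {c : G.PlusComponent} {i : V} :
    i ∈ G.pieceNodes (some c) ↔ i ∈ G.compNodes c ∪ G.neighborhood (G.compNodes c) := by
  simp [pieceNodes]

theorem mem_pieceNodes_none {i : V} : i ∈ G.pieceNodes none ↔ i ∉ G.plus := by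
  simp [pieceNodes]

theorem mem_compNodes_iff_mem_pieceNodes {c : G.PlusComponent} {i : V} :
    i ∈ G.compNodes c ↔ i ∈ G.plus ∧ i ∈ G.pieceNodes (some c) := by
  rw [mem_pieceNodes_some]
  exact ⟨fun h => ⟨G.compNodes_subset_plus c h, Or.inl h⟩,
    fun ⟨hp, h⟩ => h.resolve_right fun hn => G.notMem_plus_of_mem_neighborhood hn hp⟩

theorem isGluing_pieces : LoopHypergraph.IsGluing G.toHypergraph
    (fun c => G.toHypergraph.inducedCompletion (G.pieceNodes c)) none := by
  apply LoopHypergraph.isGluing_inducedCompletion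
  · intro i _
    by_cases hi : i ∈ G.plus
    · obtain ⟨c, hc⟩ := G.exists_mem_compNodes hi
      exact ⟨some c, G.mem_pieceNodes_some.2 (Or.inl hc)⟩
    · exact ⟨none, G.mem_pieceNodes_none.2 hi⟩
  -- An edge with a plus endpoint lies in the piece of that endpoint's component; every other edge
  -- lies in the piece `none`.
  · have key : ∀ i j, G.graph.Adj i j → i ∈ G.plus → ∃ c, {i, j} ⊆ G.pieceNodes c := by
      intro i j hij hi
      obtain ⟨c, hc⟩ := G.exists_mem_compNodes hi
      refine ⟨some c, ?_⟩
      rw [Finset.insert_subset_iff, Finset.singleton_subset_iff]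
      exact ⟨G.mem_pieceNodes_some.2 (Or.inl hc),
        G.mem_pieceNodes_some.2 (G.mem_neighborhood_of_adj hc hij)⟩
    rintro _ ⟨i, j, hij, rfl⟩
    by_cases hi : i ∈ G.plus
    · exact key i j hij hi
    by_cases hj : j ∈ G.plus
    · rw [Finset.pair_comm]
      exact key j i hij.symm hj
    refine ⟨none, ?_⟩
    rw [Finset.insert_subset_iff, Finset.singleton_subset_iff]
    exact ⟨G.mem_pieceNodes_none.2 hi, G.mem_pieceNodes_none.2 hj⟩
  · rintro (_ | c) i hi hc (_ | c') hc'
    · rfl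
    · exact absurd hi (G.mem_pieceNodes_none.1 hc)
    · exact absurd hi (G.mem_pieceNodes_none.1 hc')
    · exact congrArg some (G.eq_of_mem_compNodes
        (G.mem_compNodes_iff_mem_pieceNodes.2 ⟨hi, hc⟩)
        (G.mem_compNodes_iff_mem_pieceNodes.2 ⟨hi, hc'⟩))
  · exact fun _ _ _ hi => G.mem_pieceNodes_none.2 hi

end LoopGraph

theorem mainTheorem9 {V : Type*} [Fintype V] [DecidableEq V] (G : LoopGraph V) :
    ∃ H : Option G.PlusComponent → LoopHypergraph V,
      (∀ c : G.PlusComponent,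
        ((H (some c)).nodes : Set V) = G.compNodes c ∪ G.neighborhood (G.compNodes c) ∧
        ((H (some c)).plus : Set V) = G.compNodes c ∧
        (H (some c)).minus = G.minus ∩ (H (some c)).nodes ∧
        (H (some c)).nodes.card =
          (G.compNodes c).ncard + (G.neighborhood (G.compNodes c)).ncard ∧
        (H (some c)).plus.card = (G.compNodes c).ncard) ∧
      ((H none).nodes = Finset.univ \ G.plus ∧
        (H none).plus = ∅ ∧
        (H none).minus = G.minus ∧
        (H none).nodes.card + ∑ᶠ c : G.PlusComponent, (G.compNodes c).ncard = Fintype.card V) ∧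
      ∃ hG : G.vars ⊆ ⋃ c, (H c).vars,
        ∀ (r : Option G.PlusComponent → ℕ)
          (Q : ∀ c, Set ((H c).vars ⊕ Fin (r c) → ℝ)),
          (∀ c, IsExtendedFormulation Function.Embedding.inl (Q c) (H c).PP) →
          IsExtendedFormulation
            ((Set.embeddingOfSubset _ _ hG).trans Function.Embedding.inl)
            (putTogether H r Q) G.QP := by
  have hplus : ∀ c : G.PlusComponent,
      ((G.plus ∩ G.pieceNodes (some c) : Finset V) : Set V) = G.compNodes c := by
    intro c
    ext i
    rw [Finset.mem_coe, Finset.mem_inter, ← G.mem_compNodes_iff_mem_pieceNodes]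
  have hnodes : ∀ c : G.PlusComponent, (G.pieceNodes (some c) : Set V) =
      G.compNodes c ∪ G.neighborhood (G.compNodes c) :=
    fun c => Set.ext fun i => G.mem_pieceNodes_some
  refine ⟨fun c => G.toHypergraph.inducedCompletion (G.pieceNodes c),
    fun c => ⟨hnodes c, hplus c, rfl, ?_, ?_⟩, ⟨rfl, ?_, ?_, ?_⟩,
    G.isGluing_pieces.vars_subset, fun r Q hQ => ?_⟩
  · rw [← Set.ncard_coe_finset]
    exact (congrArg Set.ncard (hnodes c)).trans
      (Set.ncard_union_eq (G.disjoint_neighborhood _) (Set.toFinite _) (Set.toFinite _))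
  · rw [← Set.ncard_coe_finset]
    exact congrArg Set.ncard (hplus c)
  · exact Finset.inter_sdiff_self G.plus Finset.univ
  · refine Finset.inter_eq_left.2 fun i hi => G.mem_pieceNodes_none.2 fun hp => ?_
    exact Finset.disjoint_left.1 G.disjoint hp hi
  · rw [G.finsum_ncard_compNodes]
    exact Finset.card_sdiff_add_card_eq_card (Finset.subset_univ G.plus)
  · rw [G.QP_eq_PP_toHypergraph]
    exact G.isGluing_pieces.isExtendedFormulation_putTogether r Q hQ
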